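/- Let $N\ge 1$ and let $\mathbb S=\mathbb C\{0,1\}^N$ be the free complex vector space on the binary strings of length $N$; write $m_j\in\{0,1\}$ ($1\le j\le N$) for the coefficient of $2^{j-1}$ in the fixed-width binary number $m$. Define linear operators on $\mathbb S$ as follows. - For $2\le k\le N$, $B^{k}$ sends a basis vector $m$ to $m+2^{k-1}-2^{k-2}$ if this requires no carrying in any digit (that is, if $m_k=0$ and $m_{k-1}=1$), and to $0$ otherwise; $B^{-k}$ sends $m$ to $m-2^{k-1}+2^{k-2}$ if this requires no carrying (that is, if $m_k=1$ and $m_{k-1}=0$), and to $0$ otherwise. - $B^{1}$ sends $m$ to $m+1$ if $m_1=0$ and to $0$ otherwise; $B^{-1}$ sends $m$ to $m-1$ if $m_1=1$ and to $0$ otherwise. - For $1\le l\le N$, $p_l$ sends $m$ to $(-1)^{m_l}m$. Let $\mathfrak k_N\subset\operatorname{End}_{\mathbb C}(\mathbb S)$ be the real Lie algebra generated, under the commutator bracket, by $$Q^k_+=B^k-B^{-k},\qquad Q^k_-=i\,(B^k+B^{-k}),\qquad i\,p_l\qquad(1\le k,l\le N).$$ Then $\mathfrak k_N$ is isomorphic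 to the compact real Lie algebra $\mathfrak{so}(2N+1)$ of real skew-symmetric $(2N+1)\times(2N+1)$ matrices, and, under a suitable isomorphism $\mathfrak{so}(2N+1)\cong\mathfrak k_N$, its representation on $\mathbb S$ is the fundamental complex spin representation of $\mathfrak{so}(2N+1)$. Here the complex spin representation is the restriction, along the embedding of Lie algebras $\mathfrak{so}(n)\to \mathrm{Cl}(\mathbb R^{n})$, $A\mapsto\frac14\sum_{i,j}A_{ij}e_ie_j$ (where $e_ie_j+e_je_i=2\delta_{ij}$, $n=2N+1$), of an irreducible complex representation of the Clifford algebra $\mathrm{Cl}(\mathbb R^{n})$; up to equivalence it does not depend on the choice of the irreducible representation. -/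

import Mathlib

attribute [local instance 100] LieRing.ofAssociativeRing

namespace BinarySpin

/-! ### Binary strings and arithmetic operators -/

/-- Binary strings of fixed width `N`, i.e. fixed width binary numbers: `m j` is the coefficient
of `2 ^ j`, so that digit number `l` (for `1 ≤ l ≤ N`) is `m (l - 1)`. -/
abbrev BinStr (N : ℕ) : Type := Fin N → Fin 2

/-- The free complex vector space on the binary strings of width `N`. -/
abbrev SpinSpace (N : ℕ) : Type := BinStr N →₀ ℂ

/-- The formal sum `∑ j, ε j * 2 ^ j` can be added to `m` digit by digit, without any carrying
or borrowing. -/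
def NoCarry {N : ℕ} (ε : Fin N → ℤ) (m : BinStr N) : Prop :=
  ∀ j, ((m j : ℕ) : ℤ) + ε j = 0 ∨ ((m j : ℕ) : ℤ) + ε j = 1

open Classical in
/-- The arithmetic function `m ↦ m + ∑ j, ε j * 2 ^ j`, which by convention fixes `m` if the
addition would require carrying. -/
noncomputable def arithFun {N : ℕ} (ε : Fin N → ℤ) (m : BinStr N) : BinStr N :=
  if NoCarry ε m then fun j => if ((m j : ℕ) : ℤ) + ε j = 1 then 1 else 0 else m

/-- The arithmetic operator of the formal sum `∑ j, ε j * 2 ^ j`: the linear operator that sends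
a basis vector `m` to `0` if the arithmetic function fixes `m`, and to its image otherwise. -/
noncomputable def arithOp {N : ℕ} (ε : Fin N → ℤ) : Module.End ℂ (SpinSpace N) :=
  Finsupp.linearCombination ℂ fun m : BinStr N =>
    if arithFun ε m = m then (0 : SpinSpace N) else Finsupp.single (arithFun ε m) 1

/-- The parity operator `m ↦ (-1) ^ (m j) m` of the digit with index `j`. -/
noncomputable def parityOp {N : ℕ} (j : Fin N) : Module.End ℂ (SpinSpace N) :=
  Finsupp.linearCombination ℂ fun m : BinStr N =>
    Finsupp.single m ((-1 : ℂ) ^ (m j : ℕ))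

/-- The formal sum `2 ^ k - 2 ^ (k - 1)` if `k ≠ 0`, and `2 ^ 0` if `k = 0`. -/
def shiftCoeff {N : ℕ} (k : Fin N) (j : Fin N) : ℤ :=
  if j = k then 1 else if (j : ℕ) + 1 = k then -1 else 0

/-- The operator `B^(k+1)`: the arithmetic operator of `2 ^ k - 2 ^ (k - 1)`, or of `1` if
`k = 0`. -/
noncomputable def Bpos {N : ℕ} (k : Fin N) : Module.End ℂ (SpinSpace N) :=
  arithOp (shiftCoeff k)

/-- The operator `B^(-(k+1))`: the arithmetic operator of `-2 ^ k + 2 ^ (k - 1)`, or of `-1` if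
`k = 0`. -/
noncomputable def Bneg {N : ℕ} (k : Fin N) : Module.End ℂ (SpinSpace N) :=
  arithOp (-shiftCoeff k)

/-- `Q₊ = B^k - B^(-k)`. -/
noncomputable def Qplus {N : ℕ} (k : Fin N) : Module.End ℂ (SpinSpace N) :=
  Bpos k - Bneg k

/-- `Q₋ = i (B^k + B^(-k))`. -/
noncomputable def Qminus {N : ℕ} (k : Fin N) : Module.End ℂ (SpinSpace N) :=
  Complex.I • (Bpos k + Bneg k)

/-- The real Lie algebra of operators on `ℂ{0,1}^N` generated by all the `Q₊`, `Q₋` and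
`i p`. -/
noncomputable def compactAlgebra (N : ℕ) : LieSubalgebra ℝ (Module.End ℂ (SpinSpace N)) :=
  LieSubalgebra.lieSpan ℝ (Module.End ℂ (SpinSpace N))
    (Set.range (Qplus (N := N)) ∪ Set.range (Qminus (N := N)) ∪
      Set.range fun l : Fin N => Complex.I • parityOp l)

/-! ### The complex spin representation of `so(n)` -/

/-- The standard positive definite quadratic form on `ℝ^n`. -/
noncomputable abbrev stdForm (n : ℕ) : QuadraticForm ℝ (Fin n → ℝ) :=
  QuadraticMap.weightedSumSquares ℝ fun _ : Fin n => (1 : ℝ)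

/-- The Clifford algebra of Euclidean space `ℝ^n`, with `v * v = ‖v‖ ^ 2`. -/
abbrev Cl (n : ℕ) : Type := CliffordAlgebra (stdForm n)

/-- The Clifford generator `e i`. -/
noncomputable def cliffE {n : ℕ} (i : Fin n) : Cl n :=
  CliffordAlgebra.ι (stdForm n) (Pi.single i 1)

/-- `so(n)`: the real Lie algebra of skew-symmetric `n × n` matrices. -/
abbrev so (n : ℕ) : LieSubalgebra ℝ (Matrix (Fin n) (Fin n) ℝ) :=
  LieAlgebra.Orthogonal.so (Fin n) ℝ

/-- The linear map `A ↦ (1/4) ∑ i, ∑ j, A i j e i e j` into the Clifford algebra. -/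
noncomputable def spinLin (n : ℕ) : Matrix (Fin n) (Fin n) ℝ →ₗ[ℝ] Cl n where
  toFun A := (1 / 4 : ℝ) • ∑ i, ∑ j, A i j • (cliffE i * cliffE j)
  map_add' A B := by
    simp [add_smul, Finset.sum_add_distrib, smul_add]
  map_smul' r A := by
    simp only [Matrix.smul_apply, smul_eq_mul, mul_smul, RingHom.id_apply, Finset.smul_sum]
    simp only [smul_comm r]

theorem cliffE_anticomm {n : ℕ} (i j : Fin n) :
    (cliffE i * cliffE j + cliffE j * cliffE i : Cl n) =
      algebraMap ℝ (Cl n) (if i = j then 2 else 0) := by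
  unfold cliffE
  rw [CliffordAlgebra.ι_mul_ι_add_swap]
  congr 1
  simp only [QuadraticMap.polar, QuadraticMap.weightedSumSquares_apply, Pi.add_apply, one_smul]
  rw [← Finset.sum_sub_distrib, ← Finset.sum_sub_distrib]
  by_cases h : i = j
  · subst h
    rw [Finset.sum_eq_single i]
    · norm_num
    · intro b _ hb; simp [hb]
    · simp
  · rw [if_neg h]
    apply Finset.sum_eq_zero
    intro b _
    by_cases hi : b = i
    · subst hi; simp [h]
    · simp [hi]

/-- For skew-symmetric `A`, the commutator with the image of `A` acts on vectors as `A`. -/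
theorem spinLin_lie_cliffE {n : ℕ} (A : so n) (k : Fin n) :
    spinLin n A.1 * cliffE k - cliffE k * spinLin n A.1 = ∑ i, A.1 i k • cliffE i := by
  have hA : ∀ i j, A.1 j i = -A.1 i j := fun i j => by
    have h := (LieAlgebra.Orthogonal.mem_so (Fin n) ℝ A.1).1 A.2
    exact congrFun (congrFun h i) j
  have key : ∀ i j : Fin n, (cliffE i * cliffE j) * cliffE k - cliffE k * (cliffE i * cliffE j)
      = (if j = k then (2 : ℝ) else 0) • cliffE i - (if i = k then (2 : ℝ) else 0) • cliffE j := by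
    intro i j
    have h1 := cliffE_anticomm j k
    have h2 := cliffE_anticomm i k
    have e : (cliffE i * cliffE j) * cliffE k - cliffE k * (cliffE i * cliffE j) =
        cliffE i * (cliffE j * cliffE k + cliffE k * cliffE j) -
          (cliffE i * cliffE k + cliffE k * cliffE i) * cliffE j := by noncomm_ring
    rw [e, h1, h2, ← Algebra.commutes, Algebra.smul_def, Algebra.smul_def]
  have e : spinLin n A.1 * cliffE k - cliffE k * spinLin n A.1 =
      (1 / 4 : ℝ) • ∑ i, ∑ j, A.1 i j •
        ((cliffE i * cliffE j) * cliffE k - cliffE k * (cliffE i * cliffE j)) := by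
    simp only [spinLin, LinearMap.coe_mk, AddHom.coe_mk, smul_mul_assoc, mul_smul_comm,
      Finset.sum_mul, Finset.mul_sum, smul_sub, Finset.sum_sub_distrib]
  rw [e]
  simp only [key, smul_sub, Finset.sum_sub_distrib, ite_smul, zero_smul, smul_ite, smul_zero,
    Finset.sum_ite_eq', Finset.mem_univ, if_true]
  rw [Finset.sum_comm (γ := Fin n)]
  simp only [Finset.sum_ite_eq', Finset.mem_univ, if_true, Finset.smul_sum, smul_smul]
  rw [← Finset.sum_sub_distrib]
  refine Finset.sum_congr rfl fun i _ => ?_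
  rw [hA i k, ← sub_smul]
  congr 1
  ring

/-- The embedding `so(n) → Cl(n)` of Lie algebras, whose image is spanned by the products
`e i e j` with `i ≠ j`. -/
noncomputable def spinEmbedding (n : ℕ) : so n →ₗ⁅ℝ⁆ Cl n where
  toFun A := spinLin n A.1
  map_add' A B := by simp
  map_smul' r A := by simp
  map_lie' := by
    intro A B
    have hskew : ∀ i j, A.1 j i = -A.1 i j := fun i j => by
      have h := (LieAlgebra.Orthogonal.mem_so (Fin n) ℝ A.1).1 A.2
      exact congrFun (congrFun h i) j
    have key : ∀ i j : Fin n,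
        spinLin n A.1 * (cliffE i * cliffE j) - (cliffE i * cliffE j) * spinLin n A.1 =
          (∑ k, A.1 k i • (cliffE k * cliffE j)) + ∑ k, A.1 k j • (cliffE i * cliffE k) := by
      intro i j
      have e : spinLin n A.1 * (cliffE i * cliffE j) - (cliffE i * cliffE j) * spinLin n A.1 =
          (spinLin n A.1 * cliffE i - cliffE i * spinLin n A.1) * cliffE j +
            cliffE i * (spinLin n A.1 * cliffE j - cliffE j * spinLin n A.1) := by noncomm_ring
      rw [e, spinLin_lie_cliffE, spinLin_lie_cliffE]
      simp only [Finset.sum_mul, Finset.mul_sum, smul_mul_assoc, mul_smul_comm]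
    have expand : spinLin n A.1 * spinLin n B.1 - spinLin n B.1 * spinLin n A.1 =
        (1 / 4 : ℝ) • ∑ i, ∑ j, B.1 i j •
          (spinLin n A.1 * (cliffE i * cliffE j) - (cliffE i * cliffE j) * spinLin n A.1) := by
      conv_lhs => rw [show spinLin n B.1 =
        (1 / 4 : ℝ) • ∑ i, ∑ j, B.1 i j • (cliffE i * cliffE j) from rfl]
      simp only [smul_mul_assoc, mul_smul_comm, Finset.sum_mul, Finset.mul_sum, smul_sub,
        Finset.sum_sub_distrib]
    rw [Ring.lie_def, expand, LieSubalgebra.coe_bracket, Ring.lie_def]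
    change (1 / 4 : ℝ) • ∑ i, ∑ j, (A.1 * B.1 - B.1 * A.1) i j • (cliffE i * cliffE j) = _
    congr 1
    simp only [key, smul_add, Finset.smul_sum, smul_smul, Finset.sum_add_distrib,
      Matrix.sub_apply, Matrix.mul_apply, sub_smul, Finset.sum_smul, Finset.sum_sub_distrib]
    rw [sub_eq_add_neg]
    congr 1
    · calc ∑ i, ∑ j, ∑ k, (A.1 i k * B.1 k j) • (cliffE i * cliffE j : Cl n)
          = ∑ i, ∑ k, ∑ j, (A.1 i k * B.1 k j) • (cliffE i * cliffE j : Cl n) :=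
            Finset.sum_congr rfl fun i _ => Finset.sum_comm
        _ = ∑ k, ∑ i, ∑ j, (A.1 i k * B.1 k j) • (cliffE i * cliffE j : Cl n) :=
            Finset.sum_comm
        _ = ∑ k, ∑ j, ∑ i, (A.1 i k * B.1 k j) • (cliffE i * cliffE j : Cl n) :=
            Finset.sum_congr rfl fun i _ => Finset.sum_comm
        _ = _ := by simp only [mul_comm (B.1 _ _)]
    · simp only [← Finset.sum_neg_distrib]
      refine Finset.sum_congr rfl fun i _ => ?_
      rw [Finset.sum_comm]
      refine Finset.sum_congr rfl fun k _ => Finset.sum_congr rfl fun j _ => ?_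
      rw [hskew k j, ← neg_smul, mul_neg]

/-- A complex representation `ρ` of `so(n)` is a complex spin representation if it is the
restriction, along the embedding `so(n) → Cl(n)`, of an irreducible complex representation of the
Clifford algebra `Cl(n)`. -/
def IsComplexSpinRep {n : ℕ} {S : Type*} [AddCommGroup S] [Module ℂ S] [Module ℝ S]
    [IsScalarTower ℝ ℂ S] [SMulCommClass ℝ ℂ S] (ρ : so n →ₗ⁅ℝ⁆ Module.End ℂ S) : Prop :=
  ∃ c : Cl n →ₐ[ℝ] Module.End ℂ S,
    (Nontrivial S ∧
      ∀ W : Submodule ℂ S, (∀ x : Cl n, ∀ w ∈ W, c x w ∈ W) → W = ⊥ ∨ W = ⊤) ∧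
    ∀ A : so n, ρ A = c (spinEmbedding n A)

end BinarySpin

/-! The proof writes everything in Jordan–Wigner form. Each digit `k` has operators `X_k`, `Y_k`
that flip it and multiply by the parities of the higher digits (`Y_k` also by its own parity and
`i`). With the total parity `Z` these are `2N+1` anticommuting operators of square `1`, hence an
action of `Cl(2N+1)`.

Expanding the no-carry conditions in parities gives `X_0 Z` and `Y_0 Z` for the generators of the
lowest digit, `(X_k X_l + Y_k Y_l)/2` and `(Y_k X_l - X_k Y_l)/2` for neighbours `l + 1 = k`, and `i
p_k = X_k Y_k`. All lie in the real span of the products of two distinct gammas, which is the image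
of `so(2N+1)`. Conversely, brackets propagate `X_0 Z` and `Y_0 Z` up the digits, and brackets of the
`γ Z` produce every product of two distinct gammas (`mul_none_mem`, `mul_mem_of_mul_none_mem`). So
the image is the generated algebra (`range_spinRep`).

Faithfulness comes from positive definiteness of the form (`comp_spinEmbedding_injective`).
Irreducibility holds since parities isolate a basis vector and the `X_k` move it to any other
(`eq_bot_or_eq_top_of_gamma_mem`). -/

namespace BinarySpin

variable {N : ℕ}

/-! ### Monomial operators -/

/-- The monomial operator `m ↦ φ m • (m + s)`, where strings are added digitwise modulo `2`. -/
noncomputable def monomialOp (φ : BinStr N → ℂ) (s : BinStr N) : Module.End ℂ (SpinSpace N) :=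
  Finsupp.linearCombination ℂ fun m : BinStr N => Finsupp.single (m + s) (φ m)

@[simp]
theorem monomialOp_single (φ : BinStr N → ℂ) (s m : BinStr N) (a : ℂ) :
    monomialOp φ s (Finsupp.single m a) = Finsupp.single (m + s) (a * φ m) := by
  simp [monomialOp]

theorem end_ext {f g : Module.End ℂ (SpinSpace N)}
    (h : ∀ m, f (Finsupp.single m 1) = g (Finsupp.single m 1)) : f = g := by
  refine Finsupp.lhom_ext fun m a => ?_
  have e : Finsupp.single m a = a • (Finsupp.single m 1 : SpinSpace N) := by simp
  rw [e, map_smul, map_smul, h]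

/-- With this rule, operator identities reduce to scalar identities between coefficient functions.
-/
theorem monomialOp_mul (φ ψ : BinStr N → ℂ) (s t : BinStr N) :
    monomialOp φ s * monomialOp ψ t = monomialOp (fun m => ψ m * φ (m + t)) (s + t) :=
  end_ext fun m => by simp [add_comm s t, add_assoc]

theorem monomialOp_add (φ ψ : BinStr N → ℂ) (s : BinStr N) :
    monomialOp φ s + monomialOp ψ s = monomialOp (fun m => φ m + ψ m) s :=
  end_ext fun m => by simp

theorem monomialOp_sub (φ ψ : BinStr N → ℂ) (s : BinStr N) :
    monomialOp φ s - monomialOp ψ s = monomialOp (fun m => φ m - ψ m) s :=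
  end_ext fun m => by simp

theorem smul_monomialOp (c : ℂ) (φ : BinStr N → ℂ) (s : BinStr N) :
    c • monomialOp φ s = monomialOp (fun m => c * φ m) s :=
  end_ext fun m => by simp

theorem algebraMap_eq_monomialOp (r : ℝ) :
    algebraMap ℝ (Module.End ℂ (SpinSpace N)) r = monomialOp (fun _ => (r : ℂ)) 0 :=
  end_ext fun m => by simp [Algebra.algebraMap_eq_smul_one]

theorem binStr_add_self (s : BinStr N) : s + s = 0 := by
  ext j
  have : ∀ a : Fin 2, a + a = 0 := by decide
  simp [this]

/-! ### Sign functions -/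

/-- The sign `(-1) ^ m j`. -/
noncomputable def digitSign (j : Fin N) (m : BinStr N) : ℂ := (-1) ^ (m j : ℕ)

/-- The product of the signs of all the digits with index at least `n`. -/
noncomputable def tailSign (n : ℕ) (m : BinStr N) : ℂ :=
  ∏ j : Fin N, if n ≤ j then digitSign j m else 1

theorem digitSign_mul_self (j : Fin N) (m : BinStr N) : digitSign j m * digitSign j m = 1 := by
  rw [digitSign, ← pow_add, Even.neg_one_pow ⟨_, rfl⟩]

theorem digitSign_add_single (j l : Fin N) (m : BinStr N) :
    digitSign j (m + Pi.single l 1) = if j = l then -digitSign j m else digitSign j m := by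
  have h : ∀ a : Fin 2, ((-1 : ℂ) ^ ((a + 1 : Fin 2) : ℕ)) = -(-1) ^ (a : ℕ) := by
    intro a; fin_cases a <;> simp
  by_cases hj : j = l
  · subst hj; simp [digitSign, h]
  · simp [digitSign, hj]

theorem tailSign_mul_self (n : ℕ) (m : BinStr N) : tailSign n m * tailSign n m = 1 := by
  rw [tailSign, ← Finset.prod_mul_distrib]
  refine Finset.prod_eq_one fun j _ => ?_
  split_ifs <;> simp [digitSign_mul_self]

theorem tailSign_add_single (n : ℕ) (l : Fin N) (m : BinStr N) :
    tailSign n (m + Pi.single l 1) = if n ≤ l then -tailSign n m else tailSign n m := by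
  have h : tailSign n (m + Pi.single l 1) =
      (∏ j : Fin N, if j = l then (if n ≤ l then (-1 : ℂ) else 1) else 1) * tailSign n m := by
    rw [tailSign, tailSign, ← Finset.prod_mul_distrib]
    refine Finset.prod_congr rfl fun j _ => ?_
    rw [digitSign_add_single]
    by_cases hj : j = l
    · subst hj; by_cases hn : n ≤ j <;> simp [hn]
    · simp [hj]
  rw [h, Finset.prod_ite_eq', if_pos (Finset.mem_univ l)]
  split_ifs <;> simp

theorem tailSign_eq (k : Fin N) (m : BinStr N) :
    tailSign k m = digitSign k m * tailSign (k + 1) m := by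
  have h : digitSign k m = ∏ j : Fin N, if j = k then digitSign k m else 1 := by simp
  rw [tailSign, h, tailSign, ← Finset.prod_mul_distrib]
  refine Finset.prod_congr rfl fun j _ => ?_
  by_cases hj : j = k
  · subst hj; simp
  · have : (k : ℕ) ≤ j ↔ (k : ℕ) + 1 ≤ j := by
      have : (j : ℕ) ≠ k := fun h => hj (Fin.ext h)
      omega
    simp [hj, this]

/-- The common tail cancels, which is why products of neighbouring gammas involve only local
parities. -/
theorem tailSign_mul_tailSign_succ (k : Fin N) (m : BinStr N) :
    tailSign k m * tailSign (k + 1) m = digitSign k m := by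
  rw [tailSign_eq, mul_assoc, tailSign_mul_self, mul_one]

/-! ### Gamma operators -/

/-- The operator anticommuting with all `gammaX k` and `gammaY k`. -/
noncomputable def gammaZ (N : ℕ) : Module.End ℂ (SpinSpace N) := monomialOp (tailSign 0) 0

/-- The first Jordan–Wigner operator of the digit with index `k`. -/
noncomputable def gammaX (k : Fin N) : Module.End ℂ (SpinSpace N) :=
  monomialOp (tailSign (k + 1)) (Pi.single k 1)

/-- The second Jordan–Wigner operator of the digit with index `k`. -/
noncomputable def gammaY (k : Fin N) : Module.End ℂ (SpinSpace N) :=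
  monomialOp (fun m => Complex.I * tailSign k m) (Pi.single k 1)

/-- The family of all `2 * N + 1` gamma operators. -/
noncomputable def gamma : Option (Fin N × Bool) → Module.End ℂ (SpinSpace N)
  | none => gammaZ N
  | some (k, true) => gammaX k
  | some (k, false) => gammaY k

theorem gamma_mul_self (a : Option (Fin N × Bool)) : gamma a * gamma a = 1 := by
  have h1 : (1 : Module.End ℂ (SpinSpace N)) = monomialOp (fun _ => 1) 0 := by
    simpa using algebraMap_eq_monomialOp (N := N) 1
  rw [h1]
  rcases a with _ | ⟨k, _ | _⟩
  · simp [gamma, gammaZ, monomialOp_mul, tailSign_mul_self]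
  · simp only [gamma, gammaY, monomialOp_mul, binStr_add_self]
    congr 1; ext m
    rw [tailSign_add_single, if_pos le_rfl]
    -- Flipping digit `k` reverses its own tail; the factor `i` in `gammaY` compensates for this
    -- sign.
    linear_combination (-tailSign k m * tailSign k m) * Complex.I_mul_I + tailSign_mul_self k m
  · simp only [gamma, gammaX, monomialOp_mul, binStr_add_self]
    congr 1; ext m
    rw [tailSign_add_single, if_neg (by omega), tailSign_mul_self]

/-- For two distinct gammas, exactly one of the two coefficients changes sign under the flip made by
the other: a flip at `l` reverses the tails starting at or below `l`. -/
theorem gamma_anticomm {a b : Option (Fin N × Bool)} (hab : a ≠ b) :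
    gamma a * gamma b + gamma b * gamma a = 0 := by
  have h0 : (0 : Module.End ℂ (SpinSpace N)) = monomialOp (fun _ => 0) 0 := by
    simpa using algebraMap_eq_monomialOp (N := N) 0
  have key : ∀ (φ ψ : BinStr N → ℂ) (s t : BinStr N),
      (∀ m, ψ m * φ (m + t) + φ m * ψ (m + s) = 0) →
      monomialOp φ s * monomialOp ψ t + monomialOp ψ t * monomialOp φ s = 0 := by
    intro φ ψ s t h
    rw [monomialOp_mul, monomialOp_mul, add_comm t s, monomialOp_add]
    exact end_ext fun m => by simp [h]
  have hne : ∀ k l : Fin N, k ≠ l → (k : ℕ) < l ∨ (l : ℕ) < k := fun k l h =>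
    lt_or_gt_of_ne fun e => h (Fin.ext e)
  rcases a with _ | ⟨k, _ | _⟩ <;> rcases b with _ | ⟨l, _ | _⟩ <;>
    simp only [gamma, gammaX, gammaY, gammaZ] <;> refine key _ _ _ _ fun m => ?_
  · exact absurd rfl hab
  all_goals simp only [tailSign_add_single, add_zero, zero_le, if_true]
  all_goals try ring1
  · have := hne k l (by rintro rfl; exact hab rfl)
    split_ifs <;> first | omega | ring1
  · split_ifs <;> first | omega | ring1
  · split_ifs <;> first | omega | ring1
  · have := hne k l (by rintro rfl; exact hab rfl)
    split_ifs <;> first | omega | ring1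

theorem real_smul_end (r : ℝ) (u : Module.End ℂ (SpinSpace N)) : r • u = (r : ℂ) • u :=
  LinearMap.ext fun x => Finsupp.ext fun n => by simp

/-! ### The generators in terms of gamma operators -/

/-- The digits that a formal sum changes. -/
def changed (ε : Fin N → ℤ) : BinStr N := fun j => if ε j = 0 then 0 else 1

/-- Without carrying, each `ε j` is `0` or `±1`, and `±1` simply flips the digit. -/
theorem arithFun_of_noCarry {ε : Fin N → ℤ} {m : BinStr N} (h : NoCarry ε m) :
    arithFun ε m = m + changed ε := by
  rw [arithFun, if_pos h]
  ext j
  simp only [changed, Pi.add_apply]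
  have hj := h j
  generalize m j = a at hj
  generalize ε j = e at hj
  fin_cases a
  · rcases hj with h | h <;> simp at h <;> subst h <;> simp
  · rcases hj with h | h
    · have : e = -1 := by simp at h; omega
      subst this; simp
    · have : e = 0 := by simp at h; omega
      subst this; simp

-- For `ε = 0` this fails: the arithmetic function then fixes every string, so `arithOp` is zero
-- while the right side is the identity.
open Classical in
theorem arithOp_eq {ε : Fin N → ℤ} (hε : ε ≠ 0) :
    arithOp ε = monomialOp (fun m => if NoCarry ε m then 1 else 0) (changed ε) := by
  refine end_ext fun m => ?_
  have hc : changed ε ≠ 0 := by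
    obtain ⟨j, hj⟩ := Function.ne_iff.1 hε
    refine Function.ne_iff.2 ⟨j, ?_⟩
    simpa [changed] using hj
  by_cases h : NoCarry ε m
  · simp [arithOp, arithFun_of_noCarry h, hc, h]
  · simp [arithOp, arithFun, h]

theorem shiftCoeff_ne_zero (k : Fin N) : shiftCoeff k ≠ 0 :=
  Function.ne_iff.2 ⟨k, by simp [shiftCoeff]⟩

theorem changed_neg (ε : Fin N → ℤ) : changed (-ε) = changed ε := by
  ext j; simp [changed]

/-- The condition on the predecessor `l` is vacuous for the lowest digit, so both shapes of
generator are covered. -/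
theorem noCarry_shiftCoeff (k : Fin N) (m : BinStr N) :
    NoCarry (shiftCoeff k) m ↔ m k = 0 ∧ ∀ l : Fin N, (l : ℕ) + 1 = k → m l = 1 := by
  constructor
  · intro h
    refine ⟨?_, fun l hl => ?_⟩
    · have := h k
      simp only [shiftCoeff, if_true] at this
      omega
    · have := h l
      have hlk : l ≠ k := by rintro rfl; omega
      simp only [shiftCoeff, if_neg hlk, if_pos hl] at this
      omega
  · rintro ⟨h0, h1⟩ j
    unfold shiftCoeff
    split_ifs with hj hj'
    · subst hj; simp [h0]
    · simp [h1 j hj']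
    · omega

theorem noCarry_neg_shiftCoeff (k : Fin N) (m : BinStr N) :
    NoCarry (-shiftCoeff k) m ↔ m k = 1 ∧ ∀ l : Fin N, (l : ℕ) + 1 = k → m l = 0 := by
  constructor
  · intro h
    refine ⟨?_, fun l hl => ?_⟩
    · have := h k
      simp only [shiftCoeff, if_true, Pi.neg_apply] at this
      omega
    · have := h l
      have hlk : l ≠ k := by rintro rfl; omega
      simp only [shiftCoeff, if_neg hlk, if_pos hl, Pi.neg_apply] at this
      omega
  · rintro ⟨h0, h1⟩ j
    simp only [shiftCoeff, Pi.neg_apply]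
    split_ifs with hj hj'
    · subst hj; simp [h0]
    · simp [h1 j hj']
    · omega

theorem changed_shiftCoeff_zero {k : Fin N} (hk : (k : ℕ) = 0) :
    changed (shiftCoeff k) = Pi.single k 1 := by
  ext j
  by_cases hj : j = k
  · subst hj; simp [changed, shiftCoeff]
  · simp [changed, shiftCoeff, hj, hk]

theorem changed_shiftCoeff_succ {k l : Fin N} (hl : (l : ℕ) + 1 = k) :
    changed (shiftCoeff k) = Pi.single k 1 + Pi.single l 1 := by
  have hlk : l ≠ k := by rintro rfl; omega
  ext j
  by_cases hj : j = k
  · subst hj; simp [changed, shiftCoeff, hlk.symm]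
  · by_cases hj' : j = l
    · subst hj'; simp [changed, shiftCoeff, hlk, hl]
    · have : (j : ℕ) + 1 ≠ k := fun h => hj' (Fin.ext (by omega))
      simp [changed, shiftCoeff, hj, hj', this]

theorem Bpos_zero {k : Fin N} (hk : (k : ℕ) = 0) :
    Bpos k = monomialOp (fun m => (1 + digitSign k m) / 2) (Pi.single k 1) := by
  rw [Bpos, arithOp_eq (shiftCoeff_ne_zero k), changed_shiftCoeff_zero hk]
  congr 1; ext m
  simp only [noCarry_shiftCoeff, digitSign]
  generalize m k = a
  fin_cases a <;> simp [hk]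

theorem Bneg_zero {k : Fin N} (hk : (k : ℕ) = 0) :
    Bneg k = monomialOp (fun m => (1 - digitSign k m) / 2) (Pi.single k 1) := by
  rw [Bneg, arithOp_eq (neg_ne_zero.2 (shiftCoeff_ne_zero k)), changed_neg,
    changed_shiftCoeff_zero hk]
  congr 1; ext m
  simp only [noCarry_neg_shiftCoeff, digitSign]
  generalize m k = a
  fin_cases a <;> simp [hk]

theorem forall_pred_iff {k l : Fin N} (hl : (l : ℕ) + 1 = k) (P : Fin N → Prop) :
    (∀ j : Fin N, (j : ℕ) + 1 = k → P j) ↔ P l :=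
  ⟨fun h => h l hl, fun h j hj => by
    have : j = l := Fin.ext (by omega)
    exact this ▸ h⟩

/-- `(1 ± digitSign) / 2` is the indicator of a digit being `0` or `1`. -/
theorem Bpos_succ {k l : Fin N} (hl : (l : ℕ) + 1 = k) :
    Bpos k = monomialOp (fun m => (1 + digitSign k m) * (1 - digitSign l m) / 4)
      (Pi.single k 1 + Pi.single l 1) := by
  rw [Bpos, arithOp_eq (shiftCoeff_ne_zero k), changed_shiftCoeff_succ hl]
  congr 1; ext m
  simp only [noCarry_shiftCoeff, digitSign, forall_pred_iff hl fun j => m j = 1]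
  generalize m k = a
  generalize m l = b
  fin_cases a <;> fin_cases b <;> norm_num

theorem Bneg_succ {k l : Fin N} (hl : (l : ℕ) + 1 = k) :
    Bneg k = monomialOp (fun m => (1 - digitSign k m) * (1 + digitSign l m) / 4)
      (Pi.single k 1 + Pi.single l 1) := by
  rw [Bneg, arithOp_eq (neg_ne_zero.2 (shiftCoeff_ne_zero k)), changed_neg,
    changed_shiftCoeff_succ hl]
  congr 1; ext m
  simp only [noCarry_neg_shiftCoeff, digitSign, forall_pred_iff hl fun j => m j = 0]
  generalize m k = a
  generalize m l = b
  fin_cases a <;> fin_cases b <;> norm_num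

theorem Qplus_zero {k : Fin N} (hk : (k : ℕ) = 0) : Qplus k = gammaX k * gammaZ N := by
  rw [Qplus, Bpos_zero hk, Bneg_zero hk, monomialOp_sub, gammaX, gammaZ, monomialOp_mul, add_zero]
  congr 1; ext m
  have := tailSign_mul_tailSign_succ k m
  rw [hk] at this ⊢
  rw [add_zero, this]; ring

theorem Qminus_zero {k : Fin N} (hk : (k : ℕ) = 0) : Qminus k = gammaY k * gammaZ N := by
  rw [Qminus, Bpos_zero hk, Bneg_zero hk, monomialOp_add, gammaY, gammaZ, monomialOp_mul, add_zero,
    smul_monomialOp]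
  congr 1; ext m
  rw [hk, add_zero]
  linear_combination (-Complex.I) * tailSign_mul_self 0 m

/-- With `a`, `b` the signs of digits `k`, `l`, the coefficient of `Qplus k` is `(a - b) / 2`; `X_k
X_l` contributes `a` and `Y_k Y_l` contributes `-b`. -/
theorem Qplus_succ {k l : Fin N} (hl : (l : ℕ) + 1 = k) :
    Qplus k = (1 / 2 : ℝ) • (gammaX k * gammaX l + gammaY k * gammaY l) := by
  rw [real_smul_end, Complex.ofReal_div, Complex.ofReal_one, Complex.ofReal_ofNat,
    Qplus, Bpos_succ hl, Bneg_succ hl, monomialOp_sub]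
  simp only [gammaX, gammaY, monomialOp_mul, monomialOp_add, smul_monomialOp]
  congr 1; ext m
  have h1 := tailSign_mul_tailSign_succ k m
  have h2 := tailSign_mul_tailSign_succ l m
  rw [hl] at h2
  simp only [tailSign_add_single]
  rw [if_neg (by omega), if_neg (by omega), hl]
  linear_combination (-1 / 2 : ℂ) * h1 + (1 / 2 : ℂ) * h2 -
    (1 / 2 : ℂ) * tailSign l m * tailSign k m * Complex.I_mul_I

/-- Here the coefficient is `i (1 - a b) / 2`; `Y_k X_l` has coefficient `i` and `X_k Y_l` has `i a
b`. -/
theorem Qminus_succ {k l : Fin N} (hl : (l : ℕ) + 1 = k) :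
    Qminus k = (1 / 2 : ℝ) • (gammaY k * gammaX l - gammaX k * gammaY l) := by
  rw [real_smul_end, Complex.ofReal_div, Complex.ofReal_one, Complex.ofReal_ofNat,
    Qminus, Bpos_succ hl, Bneg_succ hl, monomialOp_add]
  simp only [gammaX, gammaY, monomialOp_mul, monomialOp_sub, smul_monomialOp]
  congr 1; ext m
  have h1 := tailSign_mul_tailSign_succ k m
  have h2 := tailSign_mul_tailSign_succ l m
  have h3 := tailSign_mul_self (k : ℕ) m
  rw [hl] at h2
  simp only [tailSign_add_single]
  rw [if_neg (by omega), if_neg (by omega), hl]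
  have h4 : tailSign l m * tailSign (k + 1) m = digitSign k m * digitSign l m := by
    rw [← h1, ← h2]; linear_combination (-tailSign l m * tailSign (k + 1) m) * h3
  linear_combination (-Complex.I / 2) * h3 + (Complex.I / 2) * h4

theorem I_smul_parityOp (k : Fin N) : Complex.I • parityOp k = gammaX k * gammaY k := by
  have h : parityOp k = monomialOp (digitSign k) 0 :=
    end_ext fun m => by simp [parityOp, digitSign]
  rw [h, gammaX, gammaY, monomialOp_mul, binStr_add_self, smul_monomialOp]
  congr 1; ext m
  have h1 := tailSign_mul_tailSign_succ k m
  rw [tailSign_add_single, if_neg (by omega)]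
  linear_combination (-Complex.I) * h1

/-! ### Lie subalgebras containing products of anticommuting elements -/

section Anticommuting

variable {A : Type*} [Ring A]

theorem lie_mul_mul_right {a b c : A} (hb : b * b = 1)
    (hab : a * b + b * a = 0) (hcb : c * b + b * c = 0) :
    ⁅a * b, c * b⁆ = c * a - a * c := by
  have h : ∀ x y : A, y * b + b * y = 0 → x * b * (y * b) = -(x * y) := fun x y hy => by
    rw [eq_neg_of_add_eq_zero_left hy, mul_neg, mul_assoc x, ← mul_assoc b, hb, one_mul]
  rw [Ring.lie_def, h a c hcb, h c a hab]
  abel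

theorem lie_mul_mul_of_anticomm {a b c d : A} (hac : a * c + c * a = 0)
    (had : a * d + d * a = 0) (hbc : b * c + c * b = 0) (hbd : b * d + d * b = 0) :
    ⁅a * b, c * d⁆ = 0 := by
  rw [Ring.lie_def]
  calc a * b * (c * d) - c * d * (a * b) =
        a * (b * c + c * b) * d - (a * c + c * a) * (b * d) + c * a * (b * d + d * b)
          - c * (a * d + d * a) * b := by noncomm_ring
    _ = 0 := by rw [hac, had, hbc, hbd]; simp

variable [Algebra ℝ A]

theorem half_smul_add_self (u : A) : (1 / 2 : ℝ) • (u + u) = u := by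
  rw [← two_smul ℝ, smul_smul]; norm_num

/-- Bracketing with `b * z` replaces the shared factor `b` of `a * b` by `z`, up to a factor `2`,
and kills `c * d`, which shares no factor with it. -/
theorem half_smul_lie_eq {a b c d z : A} (hb : b * b = 1) (hab : a * b + b * a = 0)
    (hzb : z * b + b * z = 0) (hza : z * a + a * z = 0)
    (hcb : c * b + b * c = 0) (hcz : c * z + z * c = 0)
    (hdb : d * b + b * d = 0) (hdz : d * z + z * d = 0) (r : ℝ) :
    ⁅(1 / 2 : ℝ) • (a * b + r • (c * d)), b * z⁆ = a * z := by
  have ebz : b * z = -(z * b) := eq_neg_of_add_eq_zero_right hzb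
  have e1 : ⁅a * b, b * z⁆ = a * z + a * z := by
    rw [ebz, lie_neg, lie_mul_mul_right hb hab hzb, eq_neg_of_add_eq_zero_left hza]
    abel
  have e2 : ⁅c * d, b * z⁆ = 0 := lie_mul_mul_of_anticomm hcb hcz hdb hdz
  have e3 : ⁅a * b + r • (c * d), b * z⁆ = ⁅a * b, b * z⁆ + r • ⁅c * d, b * z⁆ := by
    simp only [Ring.lie_def, add_mul, mul_add, smul_mul_assoc, mul_smul_comm, smul_sub]
    abel
  have e4 : ⁅(1 / 2 : ℝ) • (a * b + r • (c * d)), b * z⁆ =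
      (1 / 2 : ℝ) • ⁅a * b + r • (c * d), b * z⁆ := by
    simp only [Ring.lie_def, smul_mul_assoc, mul_smul_comm, smul_sub]
  rw [e4, e3, e1, e2, smul_zero, add_zero, half_smul_add_self]

variable {g : Option (Fin N × Bool) → A} {L : LieSubalgebra ℝ A}

/-- Induction up the digits: bracketing a neighbour generator with `X_l Z` turns it into `X_k Z` or
`Y_k Z`. -/
theorem mul_none_mem (hsq : ∀ a, g a * g a = 1)
    (hanti : ∀ a b, a ≠ b → g a * g b + g b * g a = 0)
    (hzero : ∀ k : Fin N, (k : ℕ) = 0 → ∀ i, g (some (k, i)) * g none ∈ L)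
    (hplus : ∀ k l : Fin N, (l : ℕ) + 1 = k → (1 / 2 : ℝ) • (g (some (k, true)) *
      g (some (l, true)) + g (some (k, false)) * g (some (l, false))) ∈ L)
    (hminus : ∀ k l : Fin N, (l : ℕ) + 1 = k → (1 / 2 : ℝ) • (g (some (k, false)) *
      g (some (l, true)) - g (some (k, true)) * g (some (l, false))) ∈ L) (n : ℕ) :
    ∀ k : Fin N, (k : ℕ) = n → ∀ i, g (some (k, i)) * g none ∈ L := by
  induction n with
  | zero => exact hzero
  | succ n ih =>
    intro k hk
    obtain ⟨l, hl⟩ : ∃ l : Fin N, (l : ℕ) = n := ⟨⟨n, by omega⟩, rfl⟩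
    have hlk : (l : ℕ) + 1 = k := by omega
    have hne : k ≠ l := by rintro rfl; omega
    have hx := ih l hl true
    have e : ∀ (i : Bool) (r : ℝ), ⁅(1 / 2 : ℝ) • (g (some (k, i)) * g (some (l, true)) +
        r • (g (some (k, !i)) * g (some (l, false)))), g (some (l, true)) * g none⁆ =
        g (some (k, i)) * g none := fun i r =>
      half_smul_lie_eq (hsq _) (hanti _ _ (by simp [hne])) (hanti _ _ (by simp))
        (hanti _ _ (by simp)) (hanti _ _ (by simp [hne])) (hanti _ _ (by simp))
        (hanti _ _ (by simp)) (hanti _ _ (by simp)) r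
    rintro (_ | _)
    · have := e false (-1)
      rw [neg_one_smul, ← sub_eq_add_neg] at this
      exact this ▸ LieSubalgebra.lie_mem _ (hminus k l hlk) hx
    · have := e true 1
      rw [one_smul] at this
      exact this ▸ LieSubalgebra.lie_mem _ (hplus k l hlk) hx

/-- The bracket of two products with the same last factor eliminates it and leaves twice the product
of the other two. -/
theorem mul_mem_of_mul_none_mem (hsq : ∀ a, g a * g a = 1)
    (hanti : ∀ a b, a ≠ b → g a * g b + g b * g a = 0)
    (hL : ∀ k i, g (some (k, i)) * g none ∈ L) {a b : Option (Fin N × Bool)} (hab : a ≠ b) :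
    g a * g b ∈ L := by
  rcases a with _ | p <;> rcases b with _ | q
  · exact absurd rfl hab
  · rw [eq_neg_of_add_eq_zero_left (hanti _ _ hab)]; exact neg_mem (hL _ _)
  · exact hL _ _
  · have h := LieSubalgebra.lie_mem _ (hL q.1 q.2) (hL p.1 p.2)
    rw [lie_mul_mul_right (hsq none) (hanti _ _ (by simp)) (hanti _ _ (by simp)),
      eq_neg_of_add_eq_zero_right (hanti _ _ hab), sub_neg_eq_add] at h
    have := L.smul_mem (1 / 2 : ℝ) h
    rwa [half_smul_add_self] at this

theorem sum_smul_mul_self_of_anticomm {n : ℕ} {g : Fin n → A}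
    (h : ∀ i j, g i * g j + g j * g i = if i = j then 2 else 0) (v : Fin n → ℝ) :
    (∑ i, v i • g i) * (∑ i, v i • g i) = algebraMap ℝ A (stdForm n v) := by
  set S : A := (∑ i, v i • g i) * (∑ i, v i • g i) with hS
  have e1 : S = ∑ i, ∑ j, (v i * v j) • (g i * g j) := by
    rw [hS, Finset.sum_mul_sum]
    simp only [smul_mul_assoc, mul_smul_comm, smul_smul]
    exact Finset.sum_congr rfl fun i _ => Finset.sum_congr rfl fun j _ => by
      rw [mul_comm (v j) (v i)]
  have e2 : S = ∑ i, ∑ j, (v i * v j) • (g j * g i) := by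
    rw [e1, Finset.sum_comm]
    exact Finset.sum_congr rfl fun i _ => Finset.sum_congr rfl fun j _ => by
      rw [mul_comm (v j) (v i)]
  -- Adding the double sum to its transpose brings in the anticommutators, so only diagonal terms
  -- survive.
  have e3 : S + S = algebraMap ℝ A (stdForm n v) + algebraMap ℝ A (stdForm n v) := by
    calc S + S = ∑ i, (v i * v i) • (2 : A) := by
          nth_rewrite 1 [e1]
          rw [e2]
          simp only [← Finset.sum_add_distrib, ← smul_add, h, smul_ite, smul_zero,
            Finset.sum_ite_eq, Finset.mem_univ, if_true]
      _ = _ := by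
          rw [← Finset.sum_smul, QuadraticMap.weightedSumSquares_apply,
            Algebra.algebraMap_eq_smul_one, ← smul_add, one_add_one_eq_two]
          simp only [one_smul]
  rw [← half_smul_add_self S, e3, half_smul_add_self]

/-- If `M` acts as zero, so does its commutator with `e k`, which is column `k` of `M` as a vector.
The square of that vector is the column's sum of squares, so the column vanishes. Injectivity of `c`
itself is not required. -/
theorem comp_spinEmbedding_injective [Nontrivial A] {n : ℕ} (c : Cl n →ₐ[ℝ] A) :
    Function.Injective fun M : so n => c (spinEmbedding n M) := by
  have h0 : ∀ M : so n, c (spinLin n M.1) = 0 → M = 0 := by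
    intro M h
    refine Subtype.ext (Matrix.ext fun i k => ?_)
    have h1 := congrArg c (spinLin_lie_cliffE M k)
    rw [map_sub, map_mul, map_mul, h, zero_mul, mul_zero, sub_zero] at h1
    have h2 : ∑ i, M.1 i k • cliffE i = CliffordAlgebra.ι (stdForm n) fun i => M.1 i k := by
      simp only [cliffE, ← map_smul, ← map_sum]
      congr 1
      ext j
      simp [Finset.sum_apply, Pi.single_apply]
    have h3 := congrArg c (CliffordAlgebra.ι_sq_scalar (stdForm n) fun i => M.1 i k)
    rw [map_mul, ← h2, ← h1, mul_zero, AlgHom.commutes, eq_comm,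
      map_eq_zero_iff _ (algebraMap ℝ A).injective, QuadraticMap.weightedSumSquares_apply] at h3
    simp only [one_smul] at h3
    exact mul_self_eq_zero.1 ((Finset.sum_eq_zero_iff_of_nonneg
      fun i _ => mul_self_nonneg (M.1 i k)).1 h3 i (Finset.mem_univ i))
  intro M M' h
  refine sub_eq_zero.1 (h0 (M - M') ?_)
  have : spinLin n (M - M').1 = spinEmbedding n M - spinEmbedding n M' :=
    map_sub (spinEmbedding n) M M'
  rw [this, map_sub]
  exact sub_eq_zero.2 h

end Anticommuting

theorem exists_spinEmbedding_eq {n : ℕ} {i j : Fin n} (hij : i ≠ j) :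
    ∃ M : so n, spinEmbedding n M = cliffE i * cliffE j := by
  -- The factor `2` and the doubling `e i e j - e j e i = 2 e i e j` cancel the `1/4` of `spinLin`.
  have hM : (2 : ℝ) • (Matrix.single i j (1 : ℝ) - Matrix.single j i 1) ∈ so n := by
    rw [LieAlgebra.Orthogonal.mem_so]
    simp [Matrix.transpose_single, ← smul_neg]
  have hsingle : ∀ a b : Fin n, spinLin n (Matrix.single a b 1) =
      (1 / 4 : ℝ) • (cliffE a * cliffE b) := by
    intro a b
    change (1 / 4 : ℝ) • ∑ k, ∑ l, (Matrix.single a b (1 : ℝ) k l) • (cliffE k * cliffE l) = _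
    rw [Finset.sum_eq_single a, Finset.sum_eq_single b]
    · simp
    · intro l _ hl; simp [Matrix.single, hl.symm]
    · simp
    · intro k _ hk; simp [Matrix.single, hk.symm]
    · simp
  refine ⟨⟨_, hM⟩, ?_⟩
  change spinLin n _ = _
  have h := cliffE_anticomm i j
  rw [if_neg hij, map_zero] at h
  rw [map_smul, map_sub, hsingle, hsingle, eq_neg_of_add_eq_zero_right h, ← smul_sub,
    sub_neg_eq_add, ← two_smul ℝ, smul_smul, smul_smul]
  norm_num

/-! ### The Lie algebra generated -/

/-- The operators `Qplus` and `Qminus` suffice here; the `i p_l` are themselves such products. -/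
theorem gamma_mul_gamma_mem {a b : Option (Fin N × Bool)} (hab : a ≠ b) :
    gamma a * gamma b ∈ compactAlgebra N := by
  have hp : ∀ k : Fin N, Qplus k ∈ compactAlgebra N := fun k =>
    LieSubalgebra.subset_lieSpan (Or.inl (Or.inl ⟨k, rfl⟩))
  have hm : ∀ k : Fin N, Qminus k ∈ compactAlgebra N := fun k =>
    LieSubalgebra.subset_lieSpan (Or.inl (Or.inr ⟨k, rfl⟩))
  refine mul_mem_of_mul_none_mem gamma_mul_self (fun _ _ => gamma_anticomm) (fun k => ?_) hab
  refine mul_none_mem gamma_mul_self (fun _ _ => gamma_anticomm) ?_ ?_ ?_ _ k rfl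
  · rintro k hk (_ | _)
    · exact Qminus_zero hk ▸ hm k
    · exact Qplus_zero hk ▸ hp k
  · intro k l hl
    exact Qplus_succ hl ▸ hp k
  · intro k l hl
    exact Qminus_succ hl ▸ hm k

/-! ### The Clifford module -/

/-- A numbering of the gamma operators. -/
noncomputable def gammaIndex (N : ℕ) : Fin (2 * N + 1) ≃ Option (Fin N × Bool) :=
  (Fintype.equivFinOfCardEq (by simp [mul_comm])).symm

/-- The numbered gamma operators. -/
noncomputable def gammaFin (i : Fin (2 * N + 1)) : Module.End ℂ (SpinSpace N) :=
  gamma (gammaIndex N i)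

theorem gammaFin_anticomm (i j : Fin (2 * N + 1)) :
    gammaFin (N := N) i * gammaFin j + gammaFin j * gammaFin i = if i = j then 2 else 0 := by
  split_ifs with h
  · subst h; rw [gammaFin, gamma_mul_self, one_add_one_eq_two]
  · exact gamma_anticomm fun e => h ((gammaIndex N).injective e)

/-- The action of the Clifford algebra on the spin space through the gamma operators. -/
noncomputable def cliffordAction (N : ℕ) :
    Cl (2 * N + 1) →ₐ[ℝ] Module.End ℂ (SpinSpace N) :=
  CliffordAlgebra.lift (stdForm (2 * N + 1))
    ⟨Fintype.linearCombination ℝ gammaFin, fun v => by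
      simp only [Fintype.linearCombination_apply]
      exact sum_smul_mul_self_of_anticomm (g := gammaFin (N := N)) gammaFin_anticomm v⟩

theorem cliffordAction_ι (v : Fin (2 * N + 1) → ℝ) :
    cliffordAction N (CliffordAlgebra.ι _ v) = ∑ i, v i • gammaFin i := by
  simp [cliffordAction, Fintype.linearCombination_apply]

theorem cliffordAction_cliffE (i : Fin (2 * N + 1)) :
    cliffordAction N (cliffE i) = gammaFin i := by
  rw [cliffE, cliffordAction_ι]
  simp [Pi.single_apply]

/-- The spin representation on the spin space through the gamma operators. -/
noncomputable def spinRep (N : ℕ) : so (2 * N + 1) →ₗ⁅ℝ⁆ Module.End ℂ (SpinSpace N) :=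
  (AlgHom.toLieHom (cliffordAction N)).comp (spinEmbedding (2 * N + 1))

theorem spinRep_apply (A : so (2 * N + 1)) :
    spinRep N A = cliffordAction N (spinEmbedding (2 * N + 1) A) := rfl

theorem spinRep_eq_sum (A : so (2 * N + 1)) :
    spinRep N A = (1 / 4 : ℝ) • ∑ i, ∑ j, A.1 i j • (gammaFin i * gammaFin j) := by
  have : spinEmbedding (2 * N + 1) A = (1 / 4 : ℝ) • ∑ i, ∑ j, A.1 i j • (cliffE i * cliffE j) :=
    rfl
  rw [spinRep_apply, this]
  simp only [map_smul, map_sum, map_mul, cliffordAction_cliffE]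

theorem so_apply_swap {n : ℕ} (A : so n) (i j : Fin n) : A.1 j i = -A.1 i j :=
  congrFun (congrFun ((LieAlgebra.Orthogonal.mem_so (Fin n) ℝ A.1).1 A.2) i) j

theorem spinRep_mem (A : so (2 * N + 1)) : spinRep N A ∈ compactAlgebra N := by
  rw [spinRep_eq_sum]
  refine (compactAlgebra N).smul_mem _ (sum_mem fun i _ => sum_mem fun j _ => ?_)
  by_cases h : i = j
  · subst h
    -- The diagonal products are the identity; they drop out because `A` is skew-symmetric.
    have : A.1 i i = 0 := by linarith [so_apply_swap A i i]
    rw [this, zero_smul]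
    exact zero_mem _
  · exact (compactAlgebra N).smul_mem _ (gamma_mul_gamma_mem fun e => h ((gammaIndex N).injective e))

theorem gamma_mul_gamma_mem_range {a b : Option (Fin N × Bool)} (hab : a ≠ b) :
    gamma a * gamma b ∈ (spinRep N).range := by
  obtain ⟨i, rfl⟩ := (gammaIndex N).surjective a
  obtain ⟨j, rfl⟩ := (gammaIndex N).surjective b
  obtain ⟨M, hM⟩ := exists_spinEmbedding_eq (n := 2 * N + 1) (i := i) (j := j)
    fun e => hab (congrArg _ e)
  refine (LieHom.mem_range _ _).2 ⟨M, ?_⟩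
  rw [spinRep_apply, hM, map_mul, cliffordAction_cliffE, cliffordAction_cliffE]
  rfl

theorem range_spinRep (N : ℕ) : (spinRep N).range = compactAlgebra N := by
  refine le_antisymm ?_ (LieSubalgebra.lieSpan_le.2 ?_)
  · intro x hx
    obtain ⟨A, rfl⟩ := (LieHom.mem_range _ _).1 hx
    exact spinRep_mem A
  · have key : ∀ a b : Option (Fin N × Bool), a ≠ b → gamma a * gamma b ∈ (spinRep N).range :=
      fun a b => gamma_mul_gamma_mem_range
    rintro x ((⟨k, rfl⟩ | ⟨k, rfl⟩) | ⟨k, rfl⟩)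
    · rcases Nat.eq_zero_or_pos k with hk | hk
      · rw [SetLike.mem_coe, Qplus_zero hk]
        exact key (some (k, true)) none (by simp)
      · obtain ⟨l, hl⟩ : ∃ l : Fin N, (l : ℕ) + 1 = k := ⟨⟨k - 1, by omega⟩, by simp; omega⟩
        have hne : k ≠ l := by rintro rfl; omega
        rw [SetLike.mem_coe, Qplus_succ hl]
        exact LieSubalgebra.smul_mem _ _ (add_mem
          (key (some (k, true)) (some (l, true)) (by simp [hne]))
          (key (some (k, false)) (some (l, false)) (by simp [hne])))
    · rcases Nat.eq_zero_or_pos k with hk | hk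
      · rw [SetLike.mem_coe, Qminus_zero hk]
        exact key (some (k, false)) none (by simp)
      · obtain ⟨l, hl⟩ : ∃ l : Fin N, (l : ℕ) + 1 = k := ⟨⟨k - 1, by omega⟩, by simp; omega⟩
        rw [SetLike.mem_coe, Qminus_succ hl]
        exact LieSubalgebra.smul_mem _ _ (sub_mem
          (key (some (k, false)) (some (l, true)) (by simp))
          (key (some (k, true)) (some (l, false)) (by simp)))
    · simp only [SetLike.mem_coe, I_smul_parityOp]
      exact key (some (k, true)) (some (k, false)) (by simp)

theorem spinRep_injective (N : ℕ) : Function.Injective (spinRep N) :=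
  fun _ _ h => comp_spinEmbedding_injective (A := Module.End ℂ (SpinSpace N)) (cliffordAction N) h

/-! ### Irreducibility -/

theorem tailSign_ne_zero (n : ℕ) (m : BinStr N) : tailSign n m ≠ 0 := fun h => by
  simpa [h] using tailSign_mul_self n m

theorem eq_bot_or_eq_top_of_gamma_mem {W : Submodule ℂ (SpinSpace N)}
    (hW : ∀ (a : Option (Fin N × Bool)), ∀ w ∈ W, gamma a w ∈ W) : W = ⊥ ∨ W = ⊤ := by
  refine or_iff_not_imp_left.2 fun hbot => ?_
  obtain ⟨w, hw, hw0⟩ := (Submodule.ne_bot_iff W).1 hbot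
  obtain ⟨m, hm⟩ : ∃ m, w m ≠ 0 := by
    by_contra! h
    exact hw0 (Finsupp.ext h)
  have hpar : ∀ (k : Fin N), ∀ w ∈ W, parityOp k w ∈ W := by
    intro k w hw
    have h := hW (some (k, true)) _ (hW (some (k, false)) w hw)
    have e : gamma (some (k, true)) (gamma (some (k, false)) w) = Complex.I • parityOp k w := by
      rw [← LinearMap.smul_apply, I_smul_parityOp]; rfl
    rw [e] at h
    exact (Submodule.smul_mem_iff _ Complex.I_ne_zero).1 h
  have hpar_apply : ∀ (k : Fin N) (w : SpinSpace N) (n : BinStr N),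
      parityOp k w n = digitSign k n * w n := by
    intro k w n
    induction w using Finsupp.induction_linear with
    | zero => simp
    | add f g hf hg => simp [hf, hg, mul_add]
    | single a b =>
      by_cases h : a = n
      · subst h; simp [parityOp, digitSign, mul_comm]
      · simp [parityOp, h]
  -- The projections `(1 ± p_k) / 2`, with signs read off from `m`, restrict the support of `w` one
  -- digit at a time; after all digits only a nonzero multiple of the basis vector `m` remains.
  have hproj : ∀ s : Finset (Fin N), ∃ v ∈ W, ∀ n : BinStr N,
      v n = if ∀ k ∈ s, n k = m k then w n else 0 := by
    intro s
    induction s using Finset.induction_on with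
    | empty => exact ⟨w, hw, by simp⟩
    | insert k s hk ih =>
      obtain ⟨v, hv, hvn⟩ := ih
      refine ⟨(1 / 2 : ℂ) • (v + digitSign k m • parityOp k v),
        W.smul_mem _ (W.add_mem hv (W.smul_mem _ (hpar k v hv))), fun n => ?_⟩
      have hs : digitSign k m * digitSign k n = if n k = m k then 1 else -1 := by
        simp only [digitSign]
        generalize m k = a
        generalize n k = b
        fin_cases a <;> fin_cases b <;> simp
      have e : ((1 / 2 : ℂ) • (v + digitSign k m • parityOp k v)) n =
          (1 + digitSign k m * digitSign k n) / 2 * v n := by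
        simp only [Finsupp.smul_apply, Finsupp.add_apply, hpar_apply, smul_eq_mul]
        ring
      rw [e, hs, hvn]
      by_cases h1 : n k = m k <;> simp [h1]
  have hsingle : (Finsupp.single m 1 : SpinSpace N) ∈ W := by
    obtain ⟨v, hv, hvn⟩ := hproj Finset.univ
    have e : v = w m • Finsupp.single m 1 := by
      ext n
      rw [hvn]
      by_cases h : m = n
      · subst h; simp
      · have : ¬∀ k ∈ Finset.univ, n k = m k := fun h' =>
          h (funext fun k => (h' k (Finset.mem_univ k)).symm)
        rw [if_neg this]; simp [h]
    rw [e] at hv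
    exact (Submodule.smul_mem_iff _ hm).1 hv
  have hflip : ∀ (k : Fin N) (n : BinStr N), (Finsupp.single n 1 : SpinSpace N) ∈ W →
      (Finsupp.single (n + Pi.single k 1) 1 : SpinSpace N) ∈ W := by
    intro k n hn
    have h := hW (some (k, true)) _ hn
    have e : gamma (some (k, true)) (Finsupp.single n 1) =
        tailSign (k + 1) n • (Finsupp.single (n + Pi.single k 1) 1 : SpinSpace N) := by
      simp [gamma, gammaX]
    rw [e] at h
    exact (Submodule.smul_mem_iff _ (tailSign_ne_zero _ _)).1 h
  -- Here `n` is the digitwise difference from `m` to the target, realised by flipping one digit at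
  -- a time.
  have hall : ∀ (n : BinStr N) (s : Finset (Fin N)),
      (Finsupp.single (m + ∑ k ∈ s, Pi.single k (n k)) 1 : SpinSpace N) ∈ W := by
    intro n s
    induction s using Finset.induction_on with
    | empty => simpa using hsingle
    | insert k s hk ih =>
      rw [Finset.sum_insert hk, add_left_comm, add_comm]
      have : n k = 0 ∨ n k = 1 := by omega
      rcases this with h | h <;> rw [h]
      · simpa using ih
      · exact hflip k _ ih
  refine Submodule.eq_top_iff'.2 fun x => ?_
  rw [← Finsupp.sum_single x]
  refine W.sum_mem fun n _ => ?_
  have h := hall (n - m) Finset.univ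
  rw [Finset.univ_sum_single, add_sub_cancel] at h
  simpa using W.smul_mem (x n) h

end BinarySpin

theorem mainTheorem4 (N : ℕ) (hN : 0 < N) :
    ∃ e : BinarySpin.so (2 * N + 1) ≃ₗ⁅ℝ⁆ BinarySpin.compactAlgebra N,
      BinarySpin.IsComplexSpinRep ((BinarySpin.compactAlgebra N).incl.comp e.toLieHom) := by
  -- The isomorphism is `spinRep` with its codomain cut down to the range, so compatibility with the
  -- Clifford action is definitional.
  refine ⟨(LieEquiv.ofInjective (BinarySpin.spinRep N) (BinarySpin.spinRep_injective N)).trans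
    (LieEquiv.ofEq _ _ (congrArg _ (BinarySpin.range_spinRep N))),
    BinarySpin.cliffordAction N, ⟨inferInstance, fun W hW => ?_⟩, fun A => rfl⟩
  refine BinarySpin.eq_bot_or_eq_top_of_gamma_mem fun a w hw => ?_
  obtain ⟨i, rfl⟩ := (BinarySpin.gammaIndex N).surjective a
  have h := hW (BinarySpin.cliffE i) w hw
  rwa [BinarySpin.cliffordAction_cliffE] at h
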